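/- Let $\mathcal X,\mathcal Y$ be measurable spaces, $\mathcal Z=\mathcal X\times\mathcal Y$, $\mathcal H\subset\mathcal Y^{\mathcal X}$ a finite non-empty hypothesis class, $\ell$ a loss with $\ell(h,\cdot):\mathcal Z\to[0,1]$ measurable for $h\in\mathcal H$, and $D_1,\dots,D_n$ ($n\ge 1$) probability distributions on $\mathcal Z$. For $h\in\mathcal H$ and $q\in\Delta(\mathcal H)$ put $\mathcal R_D(h)=\mathbb E_{z\sim D}\,\ell(h,z)$, $\mathcal R_D(q)=\sum_{f\in\mathcal H}q_f\,\mathcal R_D(f)$ and $\mathrm{OPT}=\min_{h\in\mathcal H}\max_{i}\mathcal R_{D_i}(h)$. The distributions are accessible only through example oracles $\mathrm{EX}(D_i)$, each call of which returns a fresh independent sample of $D_i$; the oracles may be called adaptively, and the sample complexity is the total number of calls. For a number $T\ge1$ of iterations and $\delta\in(0,1)$, consider the following algorithm. Write $\mathrm{Hedge}_\eta(c^{(1)},\dots,c^{(s)})$ for the probability vector whose $i$-th entry is proportional to $\exp(-\eta\sum_{\tau\le s}c^{(\tau)}_i)$. * The learner plays $\theta^{(t)}=\mathrm{Hedge}_{\eta_-}(c^{(1)},\dots,c^{(t-1)})\in\Delta(\mathcal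 H)$ with $\eta_-=\sqrt{\log|\mathcal H|/T}$. * The auditor runs the implicit-exploration variant of ELP on the partition of $\{1,\dots,n\}$ into singletons: it plays $w^{(t)}=\mathrm{Hedge}_{\eta_+}(\tilde g^{(1)},\dots,\tilde g^{(t-1)})\in\Delta_n$ with $\eta_+=\sqrt{\log(n/\delta)/(nT)}$. * For $t=1,\dots,T-1$: draw $i\sim w^{(t)}$ and $z\sim\mathrm{EX}(D_i)$ and set $c^{(t)}_f=\ell(f,z)$ for $f\in\mathcal H$; independently draw $k\sim w^{(t)}$ and $y\sim\mathrm{EX}(D_k)$ and set $\tilde g^{(t)}_k=\bigl(1-\sum_{f}\theta^{(t)}_f\,\ell(f,y)\bigr)/\bigl(w^{(t)}_k+\eta_+/2\bigr)$ and $\tilde g^{(t)}_j=0$ for $j\ne k$. * Return $q=\frac1T\sum_{t=1}^T\theta^{(t)}\in\Delta(\mathcal H)$. **Theorem.** There is a universal constant $C>0$ such that, for all such data and all $\varepsilon>0$, $\delta\in(0,1)$, if $$T\ \ge\ \frac{C}{\varepsilon^{2}}\bigl(\log|\mathcal H|+n\log(n/\delta)\bigr),$$ then with probability at least $1-\delta$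 the output $q$ is an $\varepsilon$-optimal randomized solution: $\max_{i}\mathcal R_{D_i}(q)\le\mathrm{OPT}+\varepsilon$. If $T$ is the least integer satisfying this bound, the algorithm makes at most $\frac{2C}{\varepsilon^{2}}\bigl(\log|\mathcal H|+n\log(n/\delta)\bigr)$ oracle calls; that is, its sample complexity is $O\bigl(\varepsilon^{-2}(\log|\mathcal H|+n\log(n/\delta))\bigr)$. -/

import Mathlib

/-!
Multi-distribution (collaborative) learning with on-demand access to example oracles.
-/

universe u v w

/-- A randomized algorithm with on-demand (adaptive) access to the example oracles
`EX(D_0), …, EX(D_{n-1})` of `n` unknown distributions on `Z`, with output in `α`.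
`query i next` calls `EX(D_i)` and continues with `next z` on the returned datapoint `z`;
`rand p next` draws an index `i` with probability `p i`, using internal randomness
(no oracle call), and continues with `next i`.
An algorithm of this type has no access to the distributions other than through `query`. -/
inductive OracleAlg (n : ℕ) (Z : Type u) (α : Type v) : Type (max u v) where
  | ret (a : α) : OracleAlg n Z α
  | query (i : Fin n) (next : Z → OracleAlg n Z α) : OracleAlg n Z α
  | rand (p : Fin n → ℝ) (next : Fin n → OracleAlg n Z α) : OracleAlg n Z α

namespace OracleAlg

variable {n : ℕ} {Z : Type u} {α : Type v}

/-- The law of the output, when each call to `EX(D_i)` returns a fresh sample of `D i`,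
independent of everything drawn before. -/
noncomputable def law [MeasurableSpace Z] [MeasurableSpace α]
    (D : Fin n → MeasureTheory.Measure Z) : OracleAlg n Z α → MeasureTheory.Measure α
  | ret a => MeasureTheory.Measure.dirac a
  | query i next => (D i).bind fun z => law D (next z)
  | rand p next => ∑ i, ENNReal.ofReal (p i) • law D (next i)

/-- The sample complexity: the cumulative number of calls to the example oracles, in the worst
case over the datapoints returned and over the internal randomness. -/
noncomputable def maxCalls : OracleAlg n Z α → ℕ∞
  | ret _ => 0
  | query _ next => 1 + ⨆ z, maxCalls (next z)
  | rand _ next => ⨆ i, maxCalls (next i)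

end OracleAlg

/-- Hedge (exponential gradient descent) with learning rate `η` on the probability simplex over
`ι`: the action played after the linear costs `cs`. A linear cost `c` on the simplex is
represented by its values `c i` at the vertices `e_i`. -/
noncomputable def hedge {ι : Type v} [Fintype ι] (η : ℝ) (cs : List (ι → ℝ)) : ι → ℝ :=
  fun i => Real.exp (-η * (cs.map fun c => c i).sum) /
    ∑ j, Real.exp (-η * (cs.map fun c => c j).sum)

/-- Hedge plays points of the probability simplex. -/
theorem hedge_mem_stdSimplex {ι : Type v} [Fintype ι] [Nonempty ι] (η : ℝ)
    (cs : List (ι → ℝ)) : hedge η cs ∈ stdSimplex ℝ ι := by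
  have hpos : 0 < ∑ j : ι, Real.exp (-η * (cs.map fun c => c j).sum) :=
    Finset.sum_pos (fun _ _ => Real.exp_pos _) Finset.univ_nonempty
  refine ⟨fun i => div_nonneg (Real.exp_pos _).le hpos.le, ?_⟩
  simp only [hedge]
  rw [← Finset.sum_div, div_self hpos.ne']

/-- The cost estimate of the high-probability (implicit exploration) variant of ELP, with
parameter `lam`. The algorithm played the action `w`, drew a meta-action from `w`, and observed
the costs `c` on the block `I` of the partition that contains the drawn meta-action. -/
noncomputable def elpEstimate {n : ℕ} (lam : ℝ) (w : Fin n → ℝ) (I : Finset (Fin n))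
    (c : Fin n → ℝ) : Fin n → ℝ :=
  fun i => if i ∈ I then c i / (∑ j ∈ I, w j + lam) else 0

/-- The relaxation of a loss to randomized hypotheses: the expectation of `loss f z` for `f ∼ θ`.
It is linear in `θ`, with gradient the vector `(loss f z)_f`. -/
noncomputable def relaxedLoss {Z : Type u} {K : Type v} [Fintype K] (loss : K → Z → ℝ)
    (θ : K → ℝ) (z : Z) : ℝ :=
  ∑ f, θ f * loss f z

/-- What the game dynamics remembers: the learner's actions `θ⁽¹⁾, …, θ⁽ᵗ⁾`, the linear costs
passed to the learner, and the estimated linear costs kept by the auditor. -/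
structure DynamicsState (n : ℕ) (K : Type v) where
  actions : List (K → ℝ)
  learnerCosts : List (K → ℝ)
  auditorCosts : List (Fin n → ℝ)

/-- `rounds` further rounds of the game dynamics for the relaxed loss of `loss` on the
probability simplex over `K`. The learner runs the online learning algorithm `Q`. The auditor
runs ELP with learning rate `η` and parameter `lam` on the partition of `Fin n` into singletons
(one block for each distribution, there being a single loss function). Each round

* draws an index `i` from the auditor's action and a datapoint `z` from `EX(D_i)`, and gives the
  learner the gradient of the relaxed loss at `z` as its linear cost;
* draws ELP's observed block `{k}`, for `k` from the auditor's action, and a datapoint `y` from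
  `EX(D_k)`, and lets the auditor observe its cost `1 - relaxedLoss loss θ y` on that block.

The output is the average of the learner's actions. -/
noncomputable def dynamics {n : ℕ} {Z : Type u} {K : Type v} [Fintype K] (loss : K → Z → ℝ)
    (Q : List (K → ℝ) → K → ℝ) (η lam : ℝ) :
    ℕ → DynamicsState n K → OracleAlg n Z (K → ℝ)
  | 0, s => .ret fun f => (s.actions.map fun θ => θ f).sum / s.actions.length
  | rounds + 1, s =>
    let θ := Q s.learnerCosts
    let w := hedge η s.auditorCosts
    .rand w fun i => .query i fun z =>
    .rand w fun k => .query k fun y =>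
      let learnerCosts := s.learnerCosts ++ [fun f => loss f z]
      let auditorCosts :=
        s.auditorCosts ++ [elpEstimate lam w {k} fun _ => 1 - relaxedLoss loss θ y]
      dynamics loss Q η lam rounds
        ⟨s.actions ++ [Q learnerCosts], learnerCosts, auditorCosts⟩

/-- The multi-distribution learning algorithm with `T` iterations on the randomized hypotheses
over `K`, for the learner's online learning algorithm `Q`. The first iteration only plays the
initial actions. ELP is tuned to the horizon `T` and the confidence `δ`. -/
noncomputable def multiDistLearn (n : ℕ) {Z : Type u} {K : Type v} [Fintype K]
    (loss : K → Z → ℝ) (Q : List (K → ℝ) → K → ℝ) (T : ℕ) (δ : ℝ) : OracleAlg n Z (K → ℝ) :=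
  let η := Real.sqrt (Real.log (n / δ) / (n * T))
  dynamics loss Q η (η / 2) (T - 1) ⟨[Q []], [], []⟩

/-- The multi-distribution learning algorithm with Hedge, at learning rate `√(log |K| / T)`, as
the learner. -/
noncomputable def hedgeMultiDistLearn (n : ℕ) {Z : Type u} {K : Type v} [Fintype K]
    (loss : K → Z → ℝ) (T : ℕ) (δ : ℝ) : OracleAlg n Z (K → ℝ) :=
  multiDistLearn n loss (hedge (Real.sqrt (Real.log (Fintype.card K) / T))) T δ

/-- The risk (expected loss) of the hypothesis `h` on the distribution `D`. -/
noncomputable def risk {X : Type u} {Y : Type v} [MeasurableSpace X] [MeasurableSpace Y]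
    (ℓ : (X → Y) → X × Y → ℝ) (D : MeasureTheory.Measure (X × Y)) (h : X → Y) : ℝ :=
  ∫ z, ℓ h z ∂D

/-- The risk of the randomized hypothesis `q ∈ Δ(H)` on the distribution `D`. -/
noncomputable def randRisk {X : Type u} {Y : Type v} [MeasurableSpace X] [MeasurableSpace Y]
    (ℓ : (X → Y) → X × Y → ℝ) (D : MeasureTheory.Measure (X × Y)) {H : Finset (X → Y)}
    (q : H → ℝ) : ℝ :=
  ∑ f, q f * risk ℓ D f

/-- `OPT`, the least worst-distribution risk of a hypothesis in `H`. -/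
noncomputable def collabOPT {X : Type u} {Y : Type v} [MeasurableSpace X] [MeasurableSpace Y]
    {n : ℕ} (ℓ : (X → Y) → X × Y → ℝ) (D : Fin n → MeasureTheory.Measure (X × Y))
    (H : Finset (X → Y)) : ℝ :=
  ⨅ h : H, ⨆ i, risk ℓ (D i) h

/-- `q` is an `ε`-optimal randomized solution of the collaborative learning problem `(H, D)`. -/
def IsEpsOptimal {X : Type u} {Y : Type v} [MeasurableSpace X] [MeasurableSpace Y]
    {n : ℕ} (ℓ : (X → Y) → X × Y → ℝ) (D : Fin n → MeasureTheory.Measure (X × Y))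
    {H : Finset (X → Y)} (ε : ℝ) (q : H → ℝ) : Prop :=
  q ∈ stdSimplex ℝ H ∧ ⨆ i, randRisk ℓ (D i) q ≤ collabOPT ℓ D H + ε

/-! The learner and the auditor play a zero-sum game, and both regret bounds hold on every sample
path. For the learner, the standard Hedge potential argument (`hedgePotential_append_le`) is used.
For the auditor, the same argument is applied to the implicit-exploration estimates; their bias and
their second-order term are both multiples of the total estimated cost
(`DynamicsState.Invariant.next`).

Two kinds of deviation remain. Given the state, the learner's and the auditor's samples are i.i.d.,
so the mean excess of the best hypothesis `h` over the learner cancels the mean of the auditor's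
observed loss up to `opt`; an Azuma bound controls the fluctuation. Implicit exploration makes each
cumulative estimate exceed the true cumulative cost by little, because `exp (2 * lam * estimate)`
has mean at most `exp (2 * lam * cost)` (`lintegral_exp_elpEstimate_le`).

`gamePotential` adds the Azuma exponential and the `n` implicit-exploration exponentials, with
weights chosen so that its initial value is `δ`. It does not increase in mean
(`lintegral_gamePotential_next_le`), hence it bounds the probability of any event that forces it to
be at least 1 at the end (`law_dynamics_le_gamePotential`). When it stays below 1, every deviation
is small and adding the inequalities gives the risk bound (`mixedRisk_le_of_gamePotential_lt_one`).
-/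

open MeasureTheory

/-! ### States of the dynamics and their measurability -/

/-- The state of the dynamics after one more round, in which the learner received the datapoint
`z` and the auditor drew the index `k` and the datapoint `y`. -/
noncomputable def DynamicsState.next {n : ℕ} {Z : Type u} {K : Type v} [Fintype K]
    (loss : K → Z → ℝ) (Q : List (K → ℝ) → K → ℝ) (η lam : ℝ) (s : DynamicsState n K)
    (z : Z) (k : Fin n) (y : Z) : DynamicsState n K :=
  ⟨s.actions ++ [Q (s.learnerCosts ++ [fun f => loss f z])],
    s.learnerCosts ++ [fun f => loss f z],
    s.auditorCosts ++ [elpEstimate lam (hedge η s.auditorCosts) {k}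
      fun _ => 1 - relaxedLoss loss (Q s.learnerCosts) y]⟩

/-- The sufficient statistics of a state of the dynamics. -/
noncomputable def DynamicsState.stats {n : ℕ} {K : Type v} (s : DynamicsState n K) :
    ((K → ℝ) × ℝ) × (K → ℝ) × (Fin n → ℝ) :=
  ((fun f => (s.actions.map fun θ => θ f).sum, s.actions.length),
    fun f => (s.learnerCosts.map fun c => c f).sum,
    fun i => (s.auditorCosts.map fun c => c i).sum)

/-- Hedge and the averaged output depend on the histories only through `stats`, so this coarse
σ-algebra on lists is enough to make the output law a measurable function of the state. -/
noncomputable instance {n : ℕ} {K : Type v} : MeasurableSpace (DynamicsState n K) :=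
  MeasurableSpace.comap DynamicsState.stats inferInstance

namespace DynamicsState

variable {n : ℕ} {Z : Type u} {K : Type v}

theorem measurable_stats : Measurable (stats : DynamicsState n K → _) :=
  comap_measurable _

theorem measurable_sum_actions (f : K) :
    Measurable fun s : DynamicsState n K => (s.actions.map fun θ => θ f).sum :=
  (measurable_pi_apply f).comp (measurable_fst.comp (measurable_fst.comp measurable_stats))

theorem measurable_length_actions :
    Measurable fun s : DynamicsState n K => (s.actions.length : ℝ) :=
  measurable_snd.comp (measurable_fst.comp measurable_stats)

theorem measurable_sum_learnerCosts (f : K) :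
    Measurable fun s : DynamicsState n K => (s.learnerCosts.map fun c => c f).sum :=
  (measurable_pi_apply f).comp (measurable_fst.comp (measurable_snd.comp measurable_stats))

theorem measurable_sum_auditorCosts (i : Fin n) :
    Measurable fun s : DynamicsState n K => (s.auditorCosts.map fun c => c i).sum :=
  (measurable_pi_apply i).comp (measurable_snd.comp (measurable_snd.comp measurable_stats))

end DynamicsState

section Hedge

variable {A : Type*} [MeasurableSpace A] {ι : Type*} [Fintype ι]

theorem measurable_hedge (η : ℝ) {cs : A → List (ι → ℝ)}
    (h : ∀ i, Measurable fun a => ((cs a).map fun c => c i).sum) (i : ι) :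
    Measurable fun a => hedge η (cs a) i := by
  unfold hedge
  exact (Real.measurable_exp.comp ((h i).const_mul _)).div
    (Finset.measurable_sum _ fun j _ => Real.measurable_exp.comp ((h j).const_mul _))

end Hedge

namespace DynamicsState

variable {n : ℕ} {Z : Type u} {K : Type v} [Fintype K] [MeasurableSpace Z]

theorem measurable_next {loss : K → Z → ℝ} (hloss : ∀ f, Measurable (loss f)) (ηL η lam : ℝ)
    (k : Fin n) : Measurable fun p : (DynamicsState n K × Z) × Z =>
      p.1.1.next loss (hedge ηL) η lam p.1.2 k p.2 := by
  have hs : Measurable fun p : (DynamicsState n K × Z) × Z => p.1.1 :=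
    measurable_fst.comp measurable_fst
  have hz : Measurable fun p : (DynamicsState n K × Z) × Z => p.1.2 :=
    measurable_snd.comp measurable_fst
  have hl : ∀ f, Measurable fun p : (DynamicsState n K × Z) × Z =>
      ((p.1.1.learnerCosts ++ [fun f => loss f p.1.2]).map fun c => c f).sum := by
    intro f
    simp only [List.map_append, List.sum_append, List.map_cons, List.map_nil, List.sum_singleton]
    exact ((measurable_sum_learnerCosts f).comp hs).add ((hloss f).comp hz)
  have hw : ∀ i, Measurable fun p : (DynamicsState n K × Z) × Z =>
      hedge η p.1.1.auditorCosts i :=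
    measurable_hedge η fun i => (measurable_sum_auditorCosts i).comp hs
  have hθ : ∀ f, Measurable fun p : (DynamicsState n K × Z) × Z =>
      hedge ηL p.1.1.learnerCosts f :=
    measurable_hedge ηL fun i => (measurable_sum_learnerCosts i).comp hs
  have hr : Measurable fun p : (DynamicsState n K × Z) × Z =>
      relaxedLoss loss (hedge ηL p.1.1.learnerCosts) p.2 :=
    Finset.measurable_sum _ fun f _ => (hθ f).mul ((hloss f).comp measurable_snd)
  rw [measurable_comap_iff]
  refine ((measurable_pi_lambda _ fun f => ?_).prodMk ?_).prodMk
    ((measurable_pi_lambda _ fun f => hl f).prodMk (measurable_pi_lambda _ fun i => ?_))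
  · simp only [next, List.map_append, List.sum_append, List.map_cons, List.map_nil,
      List.sum_singleton]
    exact ((measurable_sum_actions f).comp hs).add (measurable_hedge ηL hl f)
  · simp only [next, List.length_append, List.length_singleton, Nat.cast_add, Nat.cast_one]
    exact (measurable_length_actions.comp hs).add_const 1
  · simp only [next, List.map_append, List.sum_append, List.map_cons, List.map_nil,
      List.sum_singleton]
    refine ((measurable_sum_auditorCosts i).comp hs).add ?_
    by_cases hi : i ∈ ({k} : Finset (Fin n))
    · simp only [elpEstimate, hi, if_true, Finset.sum_singleton]
      exact (hr.const_sub 1).div ((hw k).add_const lam)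
    · simp only [elpEstimate, hi, if_false]
      exact measurable_const

end DynamicsState

/-! ### Measurable families of mixtures -/

section Bind

variable {A B Z : Type*} [MeasurableSpace A] [MeasurableSpace B] [MeasurableSpace Z]

theorem Measurable.measure_bind_right {f : A × Z → Measure B} (hf : Measurable f)
    (μ : Measure Z) [SFinite μ] : Measurable fun a => μ.bind fun z => f (a, z) := by
  refine Measure.measurable_of_measurable_coe _ fun S hS => ?_
  have h : ∀ a, (μ.bind fun z => f (a, z)) S = ∫⁻ z, f (a, z) S ∂μ := fun a =>
    Measure.bind_apply hS (hf.comp measurable_prodMk_left).aemeasurable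
  simp only [h]
  exact ((Measure.measurable_coe hS).comp hf).lintegral_prod_right'

theorem Measurable.measure_sum_smul {ι : Type*} [Fintype ι] {w : A → ι → ℝ}
    (hw : ∀ i, Measurable fun a => w a i) {f : ι → A → Measure B} (hf : ∀ i, Measurable (f i)) :
    Measurable fun a => ∑ i, ENNReal.ofReal (w a i) • f i a := by
  refine Measure.measurable_of_measurable_coe _ fun S hS => ?_
  simp only [Measure.finsetSum_apply, Measure.smul_apply, smul_eq_mul]
  exact Finset.measurable_sum _ fun i _ =>
    (hw i).ennreal_ofReal.mul ((Measure.measurable_coe hS).comp (hf i))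

end Bind

/-! ### One draw of an index and a datapoint -/

section SampleMeasure

variable {n : ℕ} {Z : Type*} [MeasurableSpace Z]

/-- The joint law of an index `i` drawn from `w` and a datapoint drawn from `D i`. -/
noncomputable def sampleMeasure (w : Fin n → ℝ) (D : Fin n → Measure Z) : Measure (Fin n × Z) :=
  ∑ i, ENNReal.ofReal (w i) • (D i).map (Prod.mk i)

theorem lintegral_sampleMeasure (w : Fin n → ℝ) (D : Fin n → Measure Z)
    {f : Fin n × Z → ENNReal} (hf : Measurable f) :
    ∫⁻ p, f p ∂sampleMeasure w D = ∑ i, ENNReal.ofReal (w i) * ∫⁻ z, f (i, z) ∂D i := by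
  simp only [sampleMeasure, lintegral_finsetSum_measure, lintegral_smul_measure, smul_eq_mul]
  exact Finset.sum_congr rfl fun i _ => by rw [lintegral_map hf measurable_prodMk_left]

theorem isProbabilityMeasure_sampleMeasure {w : Fin n → ℝ} (hw : w ∈ stdSimplex ℝ (Fin n))
    (D : Fin n → Measure Z) [∀ i, IsProbabilityMeasure (D i)] :
    IsProbabilityMeasure (sampleMeasure w D) := by
  constructor
  have h := lintegral_sampleMeasure w D (f := fun _ => 1) measurable_const
  simp only [lintegral_const, measure_univ, mul_one, one_mul] at h
  rw [h, ← ENNReal.ofReal_sum_of_nonneg fun i _ => hw.1 i, hw.2, ENNReal.ofReal_one]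

theorem integral_sampleMeasure {w : Fin n → ℝ} (hw : ∀ i, 0 ≤ w i)
    (D : Fin n → Measure Z) [∀ i, IsProbabilityMeasure (D i)] {f : Fin n × Z → ℝ}
    (hf : Measurable f) {M : ℝ} (hM : ∀ p, ‖f p‖ ≤ M) :
    ∫ p, f p ∂sampleMeasure w D = ∑ i, w i * ∫ z, f (i, z) ∂D i := by
  unfold sampleMeasure
  rw [integral_finsetSum_measure]
  · refine Finset.sum_congr rfl fun i _ => ?_
    rw [integral_smul_measure, integral_map measurable_prodMk_left.aemeasurable
      hf.aestronglyMeasurable, ENNReal.toReal_ofReal (hw i), smul_eq_mul]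
  · intro i _
    have : IsProbabilityMeasure ((D i).map (Prod.mk i)) :=
      Measure.isProbabilityMeasure_map measurable_prodMk_left.aemeasurable
    exact (Integrable.of_bound hf.aestronglyMeasurable M (.of_forall hM)).smul_measure
      ENNReal.ofReal_ne_top

theorem sum_smul_bind_apply {B : Type*} [MeasurableSpace B] (w : Fin n → ℝ)
    (D : Fin n → Measure Z) {F : Fin n → Z → Measure B} (hF : ∀ k, Measurable (F k))
    {S : Set B} (hS : MeasurableSet S) :
    (∑ k, ENNReal.ofReal (w k) • (D k).bind (F k)) S =
      ∫⁻ q, F q.1 q.2 S ∂sampleMeasure w D := by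
  have hm : Measurable fun q : Fin n × Z => F q.1 q.2 S :=
    measurable_from_prod_countable_right fun k => (Measure.measurable_coe hS).comp (hF k)
  rw [lintegral_sampleMeasure _ _ hm]
  simp only [Measure.finsetSum_apply, Measure.smul_apply, smul_eq_mul]
  exact Finset.sum_congr rfl fun k _ => by rw [Measure.bind_apply hS (hF k).aemeasurable]

/-- Both draws of a round use the same `w`, so the round becomes a double integral against one
measure. The learner's index is integrated out unused, since only its datapoint enters the next
state. -/
theorem sum_smul_bind_sum_smul_bind_apply {B : Type*} [MeasurableSpace B] (w : Fin n → ℝ)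
    (D : Fin n → Measure Z) [∀ i, SFinite (D i)] {F : Fin n → Z × Z → Measure B}
    (hF : ∀ k, Measurable (F k)) {S : Set B} (hS : MeasurableSet S) :
    (∑ i, ENNReal.ofReal (w i) • (D i).bind fun z =>
        ∑ k, ENNReal.ofReal (w k) • (D k).bind fun y => F k (z, y)) S =
      ∫⁻ p, ∫⁻ q, F q.1 (p.2, q.2) S ∂sampleMeasure w D ∂sampleMeasure w D := by
  have hm : Measurable fun z => ∑ k, ENNReal.ofReal (w k) • (D k).bind fun y => F k (z, y) :=
    Measurable.measure_sum_smul (w := fun _ => w) (fun _ => measurable_const) fun k =>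
      Measurable.measure_bind_right (hF k) (D k)
  refine (sum_smul_bind_apply w D (fun _ => hm) hS).trans (lintegral_congr fun p => ?_)
  exact sum_smul_bind_apply w D (F := fun k y => F k (p.2, y))
    (fun k => (hF k).comp measurable_prodMk_left) hS

end SampleMeasure

/-! ### The output law -/

section Law

variable {n : ℕ} {Z : Type u} {K : Type v} [Fintype K] [MeasurableSpace Z]
  {loss : K → Z → ℝ} (hloss : ∀ f, Measurable (loss f)) (ηL η lam : ℝ)
  (D : Fin n → Measure Z)

theorem law_dynamics_succ (r : ℕ) (s : DynamicsState n K) :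
    (dynamics loss (hedge ηL) η lam (r + 1) s).law D =
      ∑ i, ENNReal.ofReal (hedge η s.auditorCosts i) • (D i).bind fun z =>
        ∑ k, ENNReal.ofReal (hedge η s.auditorCosts k) • (D k).bind fun y =>
          (dynamics loss (hedge ηL) η lam r (s.next loss (hedge ηL) η lam z k y)).law D :=
  rfl

variable [∀ i, IsProbabilityMeasure (D i)]

include hloss

theorem measurable_law_dynamics (r : ℕ) :
    Measurable fun s => (dynamics loss (hedge ηL) η lam r s).law D := by
  induction r with
  | zero =>
    refine Measure.measurable_dirac.comp (measurable_pi_lambda _ fun f => ?_)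
    exact (DynamicsState.measurable_sum_actions f).div DynamicsState.measurable_length_actions
  | succ r ih =>
    simp only [law_dynamics_succ]
    refine Measurable.measure_sum_smul
      (measurable_hedge η DynamicsState.measurable_sum_auditorCosts) fun i =>
      Measurable.measure_bind_right (f := fun p : DynamicsState n K × Z =>
        ∑ k, ENNReal.ofReal (hedge η p.1.auditorCosts k) • (D k).bind fun y =>
          (dynamics loss (hedge ηL) η lam r (p.1.next loss (hedge ηL) η lam p.2 k y)).law D)
      ?_ (D i)
    refine Measurable.measure_sum_smul (fun k => (measurable_hedge η
      DynamicsState.measurable_sum_auditorCosts k).comp measurable_fst) fun k =>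
      Measurable.measure_bind_right (f := fun q : (DynamicsState n K × Z) × Z =>
        (dynamics loss (hedge ηL) η lam r
          (q.1.1.next loss (hedge ηL) η lam q.1.2 k q.2)).law D) ?_ (D k)
    exact ih.comp (DynamicsState.measurable_next hloss ηL η lam k)

theorem law_dynamics_succ_apply (r : ℕ) (s : DynamicsState n K) {S : Set (K → ℝ)}
    (hS : MeasurableSet S) :
    (dynamics loss (hedge ηL) η lam (r + 1) s).law D S =
      ∫⁻ p, ∫⁻ q, (dynamics loss (hedge ηL) η lam r
          (s.next loss (hedge ηL) η lam p.2 q.1 q.2)).law D S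
        ∂sampleMeasure (hedge η s.auditorCosts) D ∂sampleMeasure (hedge η s.auditorCosts) D := by
  rw [law_dynamics_succ]
  exact sum_smul_bind_sum_smul_bind_apply _ D (fun k =>
    (measurable_law_dynamics hloss ηL η lam D r).comp <|
      (DynamicsState.measurable_next hloss ηL η lam k).comp <|
        (measurable_const.prodMk measurable_fst).prodMk measurable_snd) hS

theorem isProbabilityMeasure_law_dynamics [NeZero n] (r : ℕ) (s : DynamicsState n K) :
    IsProbabilityMeasure ((dynamics loss (hedge ηL) η lam r s).law D) := by
  induction r generalizing s with
  | zero => exact Measure.dirac.isProbabilityMeasure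
  | succ r ih =>
    have := isProbabilityMeasure_sampleMeasure (hedge_mem_stdSimplex η s.auditorCosts) D
    constructor
    rw [law_dynamics_succ_apply hloss ηL η lam D r s MeasurableSet.univ]
    simp

theorem law_dynamics_compl_stdSimplex [NeZero n] [Nonempty K] (r : ℕ) (s : DynamicsState n K)
    (hne : s.actions ≠ []) (hs : ∀ θ ∈ s.actions, θ ∈ stdSimplex ℝ K) :
    (dynamics loss (hedge ηL) η lam r s).law D (stdSimplex ℝ K)ᶜ = 0 := by
  have hmeas : MeasurableSet (stdSimplex ℝ K) := (isClosed_stdSimplex ℝ K).measurableSet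
  induction r generalizing s with
  | zero =>
    have hpos : (0 : ℝ) < s.actions.length := by
      exact_mod_cast List.length_pos_of_ne_nil hne
    have hmem : (fun f => (s.actions.map fun θ => θ f).sum / s.actions.length) ∈
        stdSimplex ℝ K := by
      refine ⟨fun f => div_nonneg (List.sum_nonneg ?_) hpos.le, ?_⟩
      · simp only [List.mem_map]
        rintro _ ⟨θ, hθ, rfl⟩
        exact (hs θ hθ).1 f
      · rw [← Finset.sum_div, div_eq_one_iff_eq hpos.ne']
        -- The identity between total mass and length holds for the empty list too; nonemptiness
        -- would not pass to the tail in the induction.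
        clear hne hpos
        obtain ⟨l, _, _⟩ := s
        induction l with
        | nil => simp
        | cons θ l ih =>
          simp only [List.map_cons, List.sum_cons, Finset.sum_add_distrib, List.length_cons] at ih ⊢
          rw [ih fun θ hθ => hs θ (List.mem_cons_of_mem _ hθ), (hs θ List.mem_cons_self).2]
          push_cast
          ring
    change Measure.dirac _ (stdSimplex ℝ K)ᶜ = 0
    rw [Measure.dirac_apply' _ hmeas.compl]
    simp [hmem]
  | succ r ih =>
    rw [law_dynamics_succ_apply hloss ηL η lam D r s hmeas.compl]
    have h : ∀ z k y, (dynamics loss (hedge ηL) η lam r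
        (s.next loss (hedge ηL) η lam z k y)).law D (stdSimplex ℝ K)ᶜ = 0 := by
      intro z k y
      refine ih _ (by simp [DynamicsState.next]) fun θ hθ => ?_
      simp only [DynamicsState.next, List.mem_append, List.mem_singleton] at hθ
      rcases hθ with hθ | rfl
      · exact hs θ hθ
      · exact hedge_mem_stdSimplex _ _
    simp [h]

end Law

theorem maxCalls_dynamics_le {n : ℕ} {Z : Type u} {K : Type v} [Fintype K] (loss : K → Z → ℝ)
    (Q : List (K → ℝ) → K → ℝ) (η lam : ℝ) (r : ℕ) (s : DynamicsState n K) :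
    (dynamics loss Q η lam r s).maxCalls ≤ (2 * r : ℕ) := by
  induction r generalizing s with
  | zero => simp [dynamics, OracleAlg.maxCalls]
  | succ r ih =>
    simp only [dynamics, OracleAlg.maxCalls]
    have : ((2 * (r + 1) : ℕ) : ℕ∞) = 1 + (1 + (2 * r : ℕ)) := by
      norm_cast; omega
    rw [this]
    exact iSup_le fun i => add_le_add_right (iSup_le fun z => iSup_le fun k =>
      add_le_add_right (iSup_le fun y => ih _) 1) 1

/-! ### Pathwise regret of Hedge -/

section HedgeRegret

variable {ι : Type*} [Fintype ι]

/-- Multiply by `exp x ≥ 1 + x + x ^ 2 / 2`: the product of the two quadratics is `1 + x ^ 4 / 4`.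
-/
theorem Real.exp_neg_le_quadratic {x : ℝ} (hx : 0 ≤ x) : Real.exp (-x) ≤ 1 - x + x ^ 2 / 2 := by
  have h := Real.quadratic_le_exp_of_nonneg hx
  have hpos : 0 < 1 - x + x ^ 2 / 2 := by nlinarith [sq_nonneg (x - 1)]
  rw [Real.exp_neg, inv_le_iff_one_le_mul₀ (Real.exp_pos x)]
  nlinarith [mul_le_mul_of_nonneg_left h hpos.le, sq_nonneg (x ^ 2)]

theorem hedge_pos [Nonempty ι] (η : ℝ) (cs : List (ι → ℝ)) (i : ι) : 0 < hedge η cs i :=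
  div_pos (Real.exp_pos _) (Finset.sum_pos (fun _ _ => Real.exp_pos _) Finset.univ_nonempty)

/-- The potential function of Hedge. -/
noncomputable def hedgePotential (η : ℝ) (cs : List (ι → ℝ)) : ℝ :=
  Real.log (∑ j, Real.exp (-η * (cs.map fun c => c j).sum))

theorem neg_mul_le_hedgePotential (η : ℝ) (cs : List (ι → ℝ)) (i : ι) :
    -η * (cs.map fun c => c i).sum ≤ hedgePotential η cs := by
  have : Nonempty ι := ⟨i⟩
  rw [hedgePotential, Real.le_log_iff_exp_le
    (Finset.sum_pos (fun _ _ => Real.exp_pos _) Finset.univ_nonempty)]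
  exact Finset.single_le_sum (f := fun j => Real.exp (-η * (cs.map fun c => c j).sum))
    (fun _ _ => (Real.exp_pos _).le) (Finset.mem_univ i)

/-- The ratio of successive partition functions is the Hedge average of `exp (-(η * c))`; expand to
second order and use `log u ≤ u - 1`. Costs need only be nonnegative, which matters for the auditor,
whose estimates may be large. -/
theorem hedgePotential_append_le [Nonempty ι] {η : ℝ} (hη : 0 ≤ η) (cs : List (ι → ℝ))
    {c : ι → ℝ} (hc : ∀ i, 0 ≤ c i) :
    hedgePotential η (cs ++ [c]) ≤ hedgePotential η cs - η * ∑ i, hedge η cs i * c i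
      + η ^ 2 / 2 * ∑ i, hedge η cs i * c i ^ 2 := by
  set W := ∑ j, Real.exp (-η * (cs.map fun c => c j).sum) with hW
  have hWpos : 0 < W := Finset.sum_pos (fun _ _ => Real.exp_pos _) Finset.univ_nonempty
  have hsum : ∑ i, hedge η cs i = 1 := (hedge_mem_stdSimplex η cs).2
  have heq : ∑ j, Real.exp (-η * ((cs ++ [c]).map fun c => c j).sum) =
      W * ∑ j, hedge η cs j * Real.exp (-(η * c j)) := by
    rw [Finset.mul_sum]
    refine Finset.sum_congr rfl fun j _ => ?_
    rw [hedge, ← hW, List.map_append, List.sum_append, mul_add, Real.exp_add]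
    simp only [List.map_cons, List.map_nil, List.sum_singleton, neg_mul]
    field_simp
  have hpos : 0 < ∑ j, hedge η cs j * Real.exp (-(η * c j)) :=
    Finset.sum_pos (fun j _ => mul_pos (hedge_pos η cs j) (Real.exp_pos _)) Finset.univ_nonempty
  have hle : ∑ j, hedge η cs j * Real.exp (-(η * c j)) ≤
      1 - η * ∑ i, hedge η cs i * c i + η ^ 2 / 2 * ∑ i, hedge η cs i * c i ^ 2 := by
    rw [← hsum, Finset.mul_sum, Finset.mul_sum, ← Finset.sum_sub_distrib, ← Finset.sum_add_distrib]
    refine Finset.sum_le_sum fun j _ => ?_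
    have := mul_le_mul_of_nonneg_left (Real.exp_neg_le_quadratic (mul_nonneg hη (hc j)))
      (hedge_pos η cs j).le
    linarith
  rw [hedgePotential, hedgePotential, heq, ← hW, Real.log_mul hWpos.ne' hpos.ne']
  linarith [Real.log_le_sub_one_of_pos hpos]

end HedgeRegret

/-! ### Exponential moments within one round -/

section Concentration

/-- Since `g ≤ 1`, replacing `lam` by `lam * g` in the denominator only increases the quotient. The
result is `2 * x / (x + 2) ≤ log (1 + x)` at `x = 2 * lam * g / w`. -/
theorem mul_exp_implicit_exploration_le {w lam g : ℝ} (hw : 0 < w) (hlam : 0 ≤ lam)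
    (hg : g ∈ Set.Icc (0 : ℝ) 1) :
    Real.exp (2 * lam * (g / (w + lam))) ≤ 1 + 2 * lam * g / w := by
  have hx : 0 ≤ 2 * lam * g / w := by have := hg.1; positivity
  rw [← Real.le_log_iff_exp_le (by linarith)]
  refine le_trans ?_ (Real.le_log_one_add_of_nonneg hx)
  have h : 2 * (2 * lam * g / w) / (2 * lam * g / w + 2) = 2 * lam * (g / (w + lam * g)) := by
    have : 0 < w + lam * g := by nlinarith [mul_nonneg hlam hg.1]
    have : 0 < 2 * lam * g + w * 2 := by nlinarith
    rw [div_add' _ _ _ hw.ne', mul_div_assoc', div_div_div_cancel_right₀ hw.ne', mul_div_assoc',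
      div_eq_div_iff (by linarith) (by linarith)]
    ring
  rw [h]
  refine mul_le_mul_of_nonneg_left (div_le_div_of_nonneg_left hg.1 ?_ ?_) (by positivity)
  · nlinarith [mul_nonneg hlam hg.1]
  · nlinarith [hg.2]

variable {n : ℕ} {Z : Type*} [MeasurableSpace Z]

theorem elpEstimate_singleton (lam : ℝ) (w : Fin n → ℝ) (k : Fin n) (g : ℝ) (j : Fin n) :
    elpEstimate lam w {k} (fun _ => g) j = if j = k then g / (w k + lam) else 0 := by
  simp [elpEstimate]

/-- The exponential is dominated by an affine function of the importance-weighted cost. In its mean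
the probability `w j` of drawing `j` cancels the weight `1 / w j`, and `1 + u ≤ exp u` finishes. -/
theorem lintegral_exp_elpEstimate_le {w : Fin n → ℝ} (hw : w ∈ stdSimplex ℝ (Fin n))
    (hpos : ∀ i, 0 < w i) {lam : ℝ} (hlam : 0 ≤ lam) (D : Fin n → Measure Z)
    [∀ i, IsProbabilityMeasure (D i)] {g : Z → ℝ} (hg : Measurable g)
    (hg01 : ∀ z, g z ∈ Set.Icc (0 : ℝ) 1) (j : Fin n) :
    ∫⁻ q, ENNReal.ofReal (Real.exp (2 * lam *
        elpEstimate lam w {q.1} (fun _ => g q.2) j)) ∂sampleMeasure w D ≤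
      ENNReal.ofReal (Real.exp (2 * lam * ∫ z, g z ∂D j)) := by
  have := isProbabilityMeasure_sampleMeasure hw D
  set h : Fin n × Z → ℝ := fun q => 1 + if j = q.1 then 2 * lam / w j * g q.2 else 0 with hh
  have hc : 0 ≤ 2 * lam / w j := by have := hpos j; positivity
  have hmeas : Measurable h := measurable_from_prod_countable_right fun k => by
    by_cases hk : j = k
    · simpa [hh, hk] using (hg.const_mul (2 * lam / w k)).const_add 1
    · simp [hh, hk]
  have h1 : ∀ q, 0 ≤ h q := fun q => by
    simp only [hh]
    split_ifs
    · have := mul_nonneg hc (hg01 q.2).1; linarith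
    · norm_num
  have hbound : ∀ q, ‖h q‖ ≤ 1 + 2 * lam / w j := fun q => by
    rw [Real.norm_of_nonneg (h1 q)]
    simp only [hh]
    split_ifs
    · have := mul_le_mul_of_nonneg_left (hg01 q.2).2 hc; linarith
    · linarith
  have hint : Integrable h (sampleMeasure w D) :=
    Integrable.of_bound hmeas.aestronglyMeasurable _ (.of_forall hbound)
  have hval : ∫ q, h q ∂sampleMeasure w D = 1 + 2 * lam * ∫ z, g z ∂D j := by
    have hgint : Integrable g (D j) := Integrable.of_bound hg.aestronglyMeasurable 1
      (.of_forall fun z => by rw [Real.norm_of_nonneg (hg01 z).1]; exact (hg01 z).2)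
    have hi : ∀ i, w i * ∫ z, h (i, z) ∂D i =
        w i + if j = i then 2 * lam * ∫ z, g z ∂D j else 0 := fun i => by
      by_cases hji : j = i
      · subst hji
        simp only [hh, if_true]
        rw [integral_add (integrable_const _) (hgint.const_mul _), integral_const_mul]
        have := (hpos j).ne'
        simp only [integral_const, probReal_univ, smul_eq_mul]
        field_simp
      · simp [hh, hji]
    rw [integral_sampleMeasure hw.1 D hmeas hbound, Finset.sum_congr rfl fun i _ => hi i,
      Finset.sum_add_distrib, hw.2]
    simp
  calc _ ≤ ∫⁻ q, ENNReal.ofReal (h q) ∂sampleMeasure w D := by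
        refine lintegral_mono fun q => ENNReal.ofReal_le_ofReal ?_
        rw [elpEstimate_singleton]
        simp only [hh]
        split_ifs with hjq
        · rw [← hjq]
          refine (mul_exp_implicit_exploration_le (hpos j) hlam (hg01 q.2)).trans_eq ?_
          ring
        · simp
    _ = ENNReal.ofReal (1 + 2 * lam * ∫ z, g z ∂D j) := by
        rw [← ofReal_integral_eq_lintegral_ofReal hint (.of_forall h1), hval]
    _ ≤ _ := ENNReal.ofReal_le_ofReal (by
        linarith [Real.add_one_le_exp (2 * lam * ∫ z, g z ∂D j)])

/-- Hoeffding's lemma; an interval of length 2 has variance proxy 1. -/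
theorem lintegral_exp_mul_centered_le {Ω : Type*} [MeasurableSpace Ω] (μ : Measure Ω)
    [IsProbabilityMeasure μ] {f : Ω → ℝ} (hf : Measurable f)
    (hb : ∀ ω, f ω ∈ Set.Icc (-1 : ℝ) 1) (s : ℝ) :
    ∫⁻ ω, ENNReal.ofReal (Real.exp (s * (f ω - ∫ ω, f ω ∂μ))) ∂μ ≤
      ENNReal.ofReal (Real.exp (s ^ 2 / 2)) := by
  have h := ProbabilityTheory.hasSubgaussianMGF_of_mem_Icc hf.aemeasurable
    (Filter.Eventually.of_forall (f := ae μ) hb)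
  rw [← ofReal_integral_eq_lintegral_ofReal (h.integrable_exp_mul s)
    (.of_forall fun _ => (Real.exp_pos _).le)]
  refine ENNReal.ofReal_le_ofReal ((h.mgf_le s).trans_eq ?_)
  norm_num

end Concentration

/-! ### Pathwise invariants and the supermartingale -/

section GamePotential

variable {n : ℕ} {Z : Type u} {K : Type v} {loss : K → Z → ℝ}

theorem integrable_loss [MeasurableSpace Z] (hloss : ∀ f, Measurable (loss f))
    (h01 : ∀ f z, loss f z ∈ Set.Icc (0 : ℝ) 1) (μ : Measure Z) [IsFiniteMeasure μ] (f : K) :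
    Integrable (loss f) μ :=
  Integrable.of_mem_Icc 0 1 (hloss f).aemeasurable (.of_forall (h01 f))

theorem integral_loss_mem_Icc [MeasurableSpace Z] (hloss : ∀ f, Measurable (loss f))
    (h01 : ∀ f z, loss f z ∈ Set.Icc (0 : ℝ) 1) (μ : Measure Z) [IsProbabilityMeasure μ] (f : K) :
    ∫ z, loss f z ∂μ ∈ Set.Icc (0 : ℝ) 1 := by
  refine ⟨integral_nonneg fun z => (h01 f z).1, ?_⟩
  have := integral_mono (integrable_loss hloss h01 μ f) (integrable_const 1)
    fun z => (h01 f z).2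
  simpa using this

variable [Fintype K]

theorem relaxedLoss_mem_Icc (h01 : ∀ f z, loss f z ∈ Set.Icc (0 : ℝ) 1) {θ : K → ℝ}
    (hθ : θ ∈ stdSimplex ℝ K) (z : Z) : relaxedLoss loss θ z ∈ Set.Icc (0 : ℝ) 1 := by
  refine ⟨Finset.sum_nonneg fun f _ => mul_nonneg (hθ.1 f) (h01 f z).1, ?_⟩
  rw [← hθ.2]
  exact Finset.sum_le_sum fun f _ => mul_le_of_le_one_right (hθ.1 f) (h01 f z).2

namespace DynamicsState

theorem sum_learnerCosts_next (Q : List (K → ℝ) → K → ℝ) (η lam : ℝ) (s : DynamicsState n K)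
    (z : Z) (k : Fin n) (y : Z) (f : K) :
    ((s.next loss Q η lam z k y).learnerCosts.map fun c => c f).sum =
      (s.learnerCosts.map fun c => c f).sum + loss f z := by
  simp [next]

theorem sum_auditorCosts_next (Q : List (K → ℝ) → K → ℝ) (η lam : ℝ) (s : DynamicsState n K)
    (z : Z) (k : Fin n) (y : Z) (j : Fin n) :
    ((s.next loss Q η lam z k y).auditorCosts.map fun c => c j).sum =
      (s.auditorCosts.map fun c => c j).sum + elpEstimate lam (hedge η s.auditorCosts) {k}
        (fun _ => 1 - relaxedLoss loss (Q s.learnerCosts) y) j := by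
  simp [next]

end DynamicsState

/-- The invariants that the dynamics satisfies deterministically after `t` rounds, where `Θ` is the
sum of the learner's actions but the last, `P` the learner's cumulative cost, and `G` the
auditor's. -/
structure DynamicsState.Invariant (ηL η lam : ℝ) (s : DynamicsState n K) (Θ : K → ℝ)
    (P G : ℝ) (t : ℕ) : Prop where
  length_actions : s.actions.length = t + 1
  sum_actions : ∀ f, (s.actions.map fun θ => θ f).sum = Θ f + hedge ηL s.learnerCosts f
  nonneg : ∀ f, 0 ≤ Θ f
  learner_regret : hedgePotential ηL s.learnerCosts ≤
    Real.log (Fintype.card K) - ηL * P + ηL ^ 2 / 2 * t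
  auditor_regret : hedgePotential η s.auditorCosts ≤
    Real.log n - η * G + η * (lam + η / 2) * ∑ j, (s.auditorCosts.map fun c => c j).sum

namespace DynamicsState

theorem Invariant.next [NeZero n] [Nonempty K] (h01 : ∀ f z, loss f z ∈ Set.Icc (0 : ℝ) 1)
    {ηL η lam : ℝ} (hηL : 0 ≤ ηL) (hη : 0 ≤ η) (hlam : 0 ≤ lam) {s : DynamicsState n K}
    {Θ : K → ℝ} {P G : ℝ} {t : ℕ} (hs : s.Invariant ηL η lam Θ P G t) (z : Z) (k : Fin n) (y : Z) :
    (s.next loss (hedge ηL) η lam z k y).Invariant ηL η lam (Θ + hedge ηL s.learnerCosts)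
      (P + relaxedLoss loss (hedge ηL s.learnerCosts) z)
      (G + (1 - relaxedLoss loss (hedge ηL s.learnerCosts) y)) (t + 1) where
  length_actions := by simp [DynamicsState.next, hs.length_actions]
  sum_actions f := by
    simp only [DynamicsState.next, List.map_append, List.sum_append, hs.sum_actions]
    simp
  nonneg f := add_nonneg (hs.nonneg f) (hedge_pos _ _ f).le
  learner_regret := by
    have h := hedgePotential_append_le hηL s.learnerCosts (c := fun f => loss f z)
      fun f => (h01 f z).1
    have h2 : ∑ f, hedge ηL s.learnerCosts f * loss f z ^ 2 ≤ 1 := by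
      rw [← (hedge_mem_stdSimplex ηL s.learnerCosts).2]
      exact Finset.sum_le_sum fun f _ => mul_le_of_le_one_right (hedge_pos _ _ f).le
        (pow_le_one₀ (h01 f z).1 (h01 f z).2)
    have h3 := mul_le_mul_of_nonneg_left h2 (by positivity : 0 ≤ ηL ^ 2 / 2)
    have h4 : relaxedLoss loss (hedge ηL s.learnerCosts) z =
      ∑ f, hedge ηL s.learnerCosts f * loss f z := rfl
    have h5 := hs.learner_regret
    simp only [DynamicsState.next]
    push_cast
    rw [h4]
    linarith
  auditor_regret := by
    set θ := hedge ηL s.learnerCosts with hθ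
    set w := hedge η s.auditorCosts with hw
    set g := 1 - relaxedLoss loss θ y with hg
    have hg01 : 0 ≤ g ∧ g ≤ 1 := by
      have := relaxedLoss_mem_Icc h01 (hedge_mem_stdSimplex ηL s.learnerCosts) y
      exact ⟨by linarith [this.2], by linarith [this.1]⟩
    have hwk : 0 < w k := hedge_pos _ _ k
    have hx : 0 ≤ g / (w k + lam) := div_nonneg hg01.1 (by linarith)
    have hest : ∀ j, elpEstimate lam w {k} (fun _ => g) j =
      if j = k then g / (w k + lam) else 0 := fun j => elpEstimate_singleton lam w k g j
    have h := hedgePotential_append_le hη s.auditorCosts (c := elpEstimate lam w {k} fun _ => g)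
      fun i => by rw [hest]; split_ifs <;> simp [hx]
    have hsum : ∑ j, elpEstimate lam w {k} (fun _ => g) j = g / (w k + lam) := by
      simp [hest]
    -- The bias of implicit exploration: the estimate accounts for `g` minus `lam` times the total
    -- estimated cost, whence the `lam` in `auditor_regret`.
    have h1 : ∑ i, w i * elpEstimate lam w {k} (fun _ => g) i = g - lam * (g / (w k + lam)) := by
      have : w k + lam ≠ 0 := by linarith
      simp only [hest, mul_ite, mul_zero, Finset.sum_ite_eq', Finset.mem_univ, if_true]
      field_simp
      ring
    -- One factor `w k * estimate ≤ 1` absorbs the square, so the second-order term is again at most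
    -- the total estimated cost.
    have h2 : ∑ i, w i * elpEstimate lam w {k} (fun _ => g) i ^ 2 ≤ g / (w k + lam) := by
      simp only [hest, ite_pow, mul_ite, ne_eq, OfNat.ofNat_ne_zero, not_false_eq_true, zero_pow,
        mul_zero, Finset.sum_ite_eq', Finset.mem_univ, if_true]
      have : w k * (g / (w k + lam)) ≤ 1 := by
        rw [mul_div_assoc', div_le_one (by linarith)]
        nlinarith
      nlinarith
    rw [← hw, h1] at h
    have h3 := mul_le_mul_of_nonneg_left h2 (by positivity : 0 ≤ η ^ 2 / 2)
    have h4 := hs.auditor_regret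
    simp only [sum_auditorCosts_next, Finset.sum_add_distrib]
    rw [← hw, ← hθ, ← hg, hsum]
    simp only [DynamicsState.next]
    rw [← hw, ← hθ, ← hg]
    nlinarith

end DynamicsState

variable [MeasurableSpace Z]

/-- The risk on `D i` of the linear combination `θ` of the hypotheses. -/
noncomputable def mixedRisk (loss : K → Z → ℝ) (D : Fin n → Measure Z) (θ : K → ℝ)
    (i : Fin n) : ℝ :=
  ∑ f, θ f * ∫ z, loss f z ∂D i

/-- The supermartingale that controls the deviations of the sampled costs from their means. -/
noncomputable def gamePotential [NeZero n] (loss : K → Z → ℝ) (D : Fin n → Measure Z)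
    (A B lam ρ opt : ℝ) (h : K) (s : DynamicsState n K) (Θ : K → ℝ) (P G : ℝ) (t : ℕ) : ℝ :=
  A * Real.exp (ρ * ((if n = 1 then mixedRisk loss D Θ 0 else t - G) - t * opt - P +
      (s.learnerCosts.map fun c => c h).sum) - ρ ^ 2 * t) +
    ∑ j, B * Real.exp (2 * lam *
      ((s.auditorCosts.map fun c => c j).sum - (t - mixedRisk loss D Θ j)))

theorem measurable_relaxedLoss (hloss : ∀ f, Measurable (loss f)) (θ : K → ℝ) :
    Measurable (relaxedLoss loss θ) :=
  Finset.measurable_sum _ fun f _ => (hloss f).const_mul _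

theorem integral_relaxedLoss (hloss : ∀ f, Measurable (loss f))
    (h01 : ∀ f z, loss f z ∈ Set.Icc (0 : ℝ) 1) (D : Fin n → Measure Z)
    [∀ i, IsProbabilityMeasure (D i)] (θ : K → ℝ) (i : Fin n) :
    ∫ z, relaxedLoss loss θ z ∂D i = mixedRisk loss D θ i := by
  unfold relaxedLoss mixedRisk
  rw [integral_finsetSum _ fun f _ => (integrable_loss hloss h01 (D i) f).const_mul _]
  simp only [integral_const_mul]

theorem mixedRisk_add (D : Fin n → Measure Z) (θ θ' : K → ℝ) (i : Fin n) :
    mixedRisk loss D (θ + θ') i = mixedRisk loss D θ i + mixedRisk loss D θ' i := by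
  simp only [mixedRisk, Pi.add_apply, add_mul, Finset.sum_add_distrib]

theorem mixedRisk_mem_Icc (hloss : ∀ f, Measurable (loss f))
    (h01 : ∀ f z, loss f z ∈ Set.Icc (0 : ℝ) 1) (D : Fin n → Measure Z)
    [∀ i, IsProbabilityMeasure (D i)] {θ : K → ℝ} (hθ : θ ∈ stdSimplex ℝ K) (i : Fin n) :
    mixedRisk loss D θ i ∈ Set.Icc (0 : ℝ) 1 :=
  relaxedLoss_mem_Icc (loss := fun f i => ∫ z, loss f z ∂D i)
    (fun f i => integral_loss_mem_Icc hloss h01 (D i) f) hθ i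

theorem lintegral_lintegral_mul_add_sum {Ω ι : Type*} [MeasurableSpace Ω] [Fintype ι]
    (μ : Measure Ω) [IsProbabilityMeasure μ] (a : ENNReal) (b : ι → ENNReal)
    {x y : Ω → ENNReal} {z : ι → Ω → ENNReal} (hx : Measurable x) (hy : Measurable y)
    (hz : ∀ j, Measurable (z j)) :
    ∫⁻ p, ∫⁻ q, (a * x p * y q + ∑ j, b j * z j q) ∂μ ∂μ =
      a * (∫⁻ p, x p ∂μ) * (∫⁻ q, y q ∂μ) + ∑ j, b j * ∫⁻ q, z j q ∂μ := by
  have h : ∀ p, ∫⁻ q, (a * x p * y q + ∑ j, b j * z j q) ∂μ =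
      a * x p * (∫⁻ q, y q ∂μ) + ∑ j, b j * ∫⁻ q, z j q ∂μ := fun p => by
    rw [lintegral_add_left (hy.const_mul _), lintegral_const_mul _ hy,
      lintegral_finsetSum _ fun j _ => (hz j).const_mul _]
    simp only [lintegral_const_mul _ (hz _)]
  simp only [h]
  rw [lintegral_add_right _ measurable_const, lintegral_mul_const _ (hx.const_mul a),
    lintegral_const_mul _ hx]
  simp

/-- Each summand is treated separately: Hoeffding twice for the Azuma term, whose factor factorizes
over the two independent samples, and the implicit-exploration moment bound for each `j`. -/
theorem lintegral_gamePotential_next_le [NeZero n] [Nonempty K]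
    (hloss : ∀ f, Measurable (loss f)) (h01 : ∀ f z, loss f z ∈ Set.Icc (0 : ℝ) 1)
    (ηL η : ℝ) {lam ρ A B opt : ℝ} (hlam : 0 ≤ lam) (hρ : 0 ≤ ρ) (hA : 0 ≤ A) (hB : 0 ≤ B)
    (D : Fin n → Measure Z) [∀ i, IsProbabilityMeasure (D i)] {h : K}
    (hopt : ∀ i, ∫ z, loss h z ∂D i ≤ opt)
    (s : DynamicsState n K) (Θ : K → ℝ) (P G : ℝ) (t : ℕ) :
    ∫⁻ p, ∫⁻ q, ENNReal.ofReal (gamePotential loss D A B lam ρ opt h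
        (s.next loss (hedge ηL) η lam p.2 q.1 q.2) (Θ + hedge ηL s.learnerCosts)
        (P + relaxedLoss loss (hedge ηL s.learnerCosts) p.2)
        (G + (1 - relaxedLoss loss (hedge ηL s.learnerCosts) q.2)) (t + 1))
        ∂sampleMeasure (hedge η s.auditorCosts) D ∂sampleMeasure (hedge η s.auditorCosts) D ≤
      ENNReal.ofReal (gamePotential loss D A B lam ρ opt h s Θ P G t) := by
  set θ := hedge ηL s.learnerCosts with hθdef
  set w := hedge η s.auditorCosts with hwdef
  have hθ : θ ∈ stdSimplex ℝ K := hedge_mem_stdSimplex _ _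
  have hw : w ∈ stdSimplex ℝ (Fin n) := hedge_mem_stdSimplex _ _
  have hprob := isProbabilityMeasure_sampleMeasure hw D
  set ν := sampleMeasure w D with hν
  have hr := measurable_relaxedLoss hloss θ
  have hr01 := relaxedLoss_mem_Icc h01 hθ
  set v : Fin n × Z → ℝ := fun q => if n = 1 then mixedRisk loss D θ 0 else relaxedLoss loss θ q.2
    with hv
  set x : Fin n × Z → ℝ := fun p => loss h p.2 - relaxedLoss loss θ p.2 with hx
  set e : Fin n → Fin n × Z → ℝ := fun j q =>
    elpEstimate lam w {q.1} (fun _ => 1 - relaxedLoss loss θ q.2) j with he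
  have hvm : Measurable v := by
    simp only [hv]
    split_ifs
    · exact measurable_const
    · exact hr.comp measurable_snd
  have hxm : Measurable x := ((hloss h).sub hr).comp measurable_snd
  have hem : ∀ j, Measurable (e j) := fun j => measurable_from_prod_countable_right fun k => by
    simp only [he, elpEstimate_singleton]
    split_ifs
    · exact (hr.const_sub 1).div_const _
    · exact measurable_const
  have hvb : ∀ q, v q ∈ Set.Icc (-1 : ℝ) 1 := fun q => by
    simp only [hv]
    split_ifs
    · have := mixedRisk_mem_Icc hloss h01 D hθ 0
      exact ⟨by linarith [this.1], this.2⟩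
    · exact ⟨by linarith [(hr01 q.2).1], (hr01 q.2).2⟩
  have hxb : ∀ q, x q ∈ Set.Icc (-1 : ℝ) 1 := fun q =>
    ⟨by linarith [(hr01 q.2).2, (h01 h q.2).1], by linarith [(hr01 q.2).1, (h01 h q.2).2]⟩
  have hvint : ∫ q, v q ∂ν = ∑ i, w i * mixedRisk loss D θ i := by
    rw [hν, integral_sampleMeasure hw.1 D hvm fun q => abs_le.2 (hvb q)]
    refine Finset.sum_congr rfl fun i _ => ?_
    congr 1
    simp only [hv]
    split_ifs with hn
    · subst hn
      simp [Subsingleton.elim i 0]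
    · exact integral_relaxedLoss hloss h01 D θ i
  -- The subtracted average equals the mean of `v`, so the means of `x` and `v` add up to at most
  -- `opt`.
  have hxint : ∫ q, x q ∂ν ≤ opt - ∑ i, w i * mixedRisk loss D θ i := by
    rw [hν, integral_sampleMeasure hw.1 D hxm fun q => abs_le.2 (hxb q)]
    have hi : ∀ i, ∫ z, x (i, z) ∂D i = (∫ z, loss h z ∂D i) - mixedRisk loss D θ i := fun i => by
      rw [← integral_relaxedLoss hloss h01 D θ i]
      exact integral_sub (integrable_loss hloss h01 (D i) h)
        (Integrable.of_mem_Icc 0 1 hr.aemeasurable (.of_forall hr01))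
    simp only [hi, mul_sub, Finset.sum_sub_distrib]
    refine sub_le_sub_right ?_ _
    calc ∑ i, w i * ∫ z, loss h z ∂D i ≤ ∑ i, w i * opt :=
          Finset.sum_le_sum fun i _ => mul_le_mul_of_nonneg_left (hopt i) (hw.1 i)
      _ = opt := by rw [← Finset.sum_mul, hw.2, one_mul]
  set a := A * Real.exp (ρ * ((if n = 1 then mixedRisk loss D Θ 0 else t - G) - t * opt - P +
      (s.learnerCosts.map fun c => c h).sum) - ρ ^ 2 * t) with ha
  set b : Fin n → ℝ := fun j => B * Real.exp (2 * lam *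
      ((s.auditorCosts.map fun c => c j).sum - (t - mixedRisk loss D Θ j))) with hb
  have ha0 : 0 ≤ a := mul_nonneg hA (Real.exp_pos _).le
  have hb0 : ∀ j, 0 ≤ b j := fun j => mul_nonneg hB (Real.exp_pos _).le
  have hpt : ∀ p q, ENNReal.ofReal (gamePotential loss D A B lam ρ opt h
        (s.next loss (hedge ηL) η lam p.2 q.1 q.2) (Θ + θ)
        (P + relaxedLoss loss θ p.2) (G + (1 - relaxedLoss loss θ q.2)) (t + 1)) ≤
      ENNReal.ofReal (a * Real.exp (-ρ ^ 2)) *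
          ENNReal.ofReal (Real.exp (ρ * (x p - ∫ p, x p ∂ν))) *
          ENNReal.ofReal (Real.exp (ρ * (v q - ∫ q, v q ∂ν))) +
        ∑ j, ENNReal.ofReal (b j * Real.exp (-(2 * lam * (1 - mixedRisk loss D θ j)))) *
          ENNReal.ofReal (Real.exp (2 * lam * e j q)) := by
    intro p q
    have hbe : ∀ j, 0 ≤ b j * Real.exp (-(2 * lam * (1 - mixedRisk loss D θ j))) := fun j =>
      mul_nonneg (hb0 j) (Real.exp_pos _).le
    simp only [← ENNReal.ofReal_mul (hbe _)]
    rw [← ENNReal.ofReal_mul (by positivity), ← ENNReal.ofReal_mul (by positivity),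
      ← ENNReal.ofReal_sum_of_nonneg fun j _ => mul_nonneg (hbe j) (Real.exp_pos _).le,
      ← ENNReal.ofReal_add (by positivity)
        (Finset.sum_nonneg fun j _ => mul_nonneg (hbe j) (Real.exp_pos _).le)]
    refine ENNReal.ofReal_le_ofReal (add_le_add ?_ (Finset.sum_le_sum fun j _ => ?_))
    · rw [ha, mul_assoc, mul_assoc, mul_assoc, ← Real.exp_add, ← Real.exp_add, ← Real.exp_add]
      refine mul_le_mul_of_nonneg_left (Real.exp_le_exp.2 ?_) hA
      rw [DynamicsState.sum_learnerCosts_next, mixedRisk_add]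
      have hvq : (if n = 1 then mixedRisk loss D Θ 0 + mixedRisk loss D θ 0
          else ((t + 1 : ℕ) : ℝ) - (G + (1 - relaxedLoss loss θ q.2))) =
          (if n = 1 then mixedRisk loss D Θ 0 else t - G) + v q := by
        simp only [hv]
        split_ifs
        · rfl
        · push_cast; ring
      rw [hvq, hvint]
      have hxp : x p = loss h p.2 - relaxedLoss loss θ p.2 := rfl
      rw [hxp]
      push_cast
      nlinarith [mul_le_mul_of_nonneg_left hxint hρ]
    · simp only [hb, mul_assoc B, ← Real.exp_add, DynamicsState.sum_auditorCosts_next,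
        mixedRisk_add]
      refine mul_le_mul_of_nonneg_left (Real.exp_le_exp.2 (le_of_eq ?_)) hB
      simp only [he]
      push_cast
      ring
  refine (lintegral_mono fun p => lintegral_mono fun q => hpt p q).trans ?_
  rw [lintegral_lintegral_mul_add_sum ν _ _ (by fun_prop) (by fun_prop) (fun j => by fun_prop)]
  have hg : gamePotential loss D A B lam ρ opt h s Θ P G t = a + ∑ j, b j := rfl
  rw [hg, ENNReal.ofReal_add ha0 (Finset.sum_nonneg fun j _ => hb0 j),
    ENNReal.ofReal_sum_of_nonneg fun j _ => hb0 j]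
  refine add_le_add ?_ (Finset.sum_le_sum fun j _ => ?_)
  · refine (mul_le_mul' (mul_le_mul_right (lintegral_exp_mul_centered_le ν hxm hxb ρ) _)
      (lintegral_exp_mul_centered_le ν hvm hvb ρ)).trans_eq ?_
    rw [← ENNReal.ofReal_mul (by positivity), ← ENNReal.ofReal_mul (by positivity), mul_assoc,
      mul_assoc, ← Real.exp_add, ← Real.exp_add]
    -- The compensator `ρ ^ 2` per round pays for one Hoeffding factor from each sample.
    rw [show -ρ ^ 2 + (ρ ^ 2 / 2 + ρ ^ 2 / 2) = 0 by ring, Real.exp_zero, mul_one]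
  · have hgint : ∫ z, (1 - relaxedLoss loss θ z) ∂D j = 1 - mixedRisk loss D θ j := by
      rw [integral_sub (integrable_const _)
        (Integrable.of_mem_Icc 0 1 hr.aemeasurable (.of_forall hr01)),
        integral_relaxedLoss hloss h01]
      simp
    have hix := lintegral_exp_elpEstimate_le hw (hedge_pos η s.auditorCosts) hlam D
      (hr.const_sub 1)
      (fun z => ⟨by linarith [(hr01 z).2], by linarith [(hr01 z).1]⟩) j
    rw [hgint] at hix
    refine (mul_le_mul_right hix _).trans_eq ?_
    rw [← ENNReal.ofReal_mul (mul_nonneg (hb0 j) (Real.exp_pos _).le), mul_assoc, ← Real.exp_add,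
      neg_add_cancel, Real.exp_zero, mul_one]

/-- Markov's inequality for the supermartingale, as an induction on the remaining rounds. `Θ`, `P`
and `G` are bookkeeping arguments updated along with the state, so no process on a path space is
needed. -/
theorem law_dynamics_le_gamePotential [NeZero n] [Nonempty K]
    (hloss : ∀ f, Measurable (loss f)) (h01 : ∀ f z, loss f z ∈ Set.Icc (0 : ℝ) 1)
    {ηL η lam ρ A B opt : ℝ} (hηL : 0 ≤ ηL) (hη : 0 ≤ η) (hlam : 0 ≤ lam) (hρ : 0 ≤ ρ)
    (hA : 0 ≤ A) (hB : 0 ≤ B)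
    (D : Fin n → Measure Z) [∀ i, IsProbabilityMeasure (D i)] {h : K}
    (hopt : ∀ i, ∫ z, loss h z ∂D i ≤ opt) {S : Set (K → ℝ)} (hS : MeasurableSet S) (N : ℕ)
    (hfinal : ∀ (s : DynamicsState n K) (Θ : K → ℝ) (P G : ℝ), s.Invariant ηL η lam Θ P G N →
      (fun f => (s.actions.map fun θ => θ f).sum / s.actions.length) ∈ S →
      1 ≤ gamePotential loss D A B lam ρ opt h s Θ P G N)
    (r : ℕ) (s : DynamicsState n K) (Θ : K → ℝ) (P G : ℝ) (t : ℕ)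
    (hs : s.Invariant ηL η lam Θ P G t) (ht : t + r = N) :
    (dynamics loss (hedge ηL) η lam r s).law D S ≤
      ENNReal.ofReal (gamePotential loss D A B lam ρ opt h s Θ P G t) := by
  induction r generalizing s Θ P G t with
  | zero =>
    obtain rfl : t = N := by simpa using ht
    change Measure.dirac (fun f => (s.actions.map fun θ => θ f).sum / s.actions.length) S ≤ _
    rw [Measure.dirac_apply' _ hS]
    refine Set.indicator_apply_le' (fun hmem => ?_) fun _ => zero_le
    exact ENNReal.one_le_ofReal.2 (hfinal s Θ P G hs hmem)
  | succ r ih =>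
    rw [law_dynamics_succ_apply hloss ηL η lam D r s hS]
    refine le_trans (lintegral_mono fun p => lintegral_mono fun q => ?_)
      (lintegral_gamePotential_next_le hloss h01 ηL η hlam hρ hA hB D hopt s Θ P G t)
    exact ih _ _ _ _ _ (hs.next h01 hηL hη hlam p.2 q.1 q.2) (by omega)

end GamePotential

/-! ### From small potential to small risk -/

section Final

/-- Every regret and deviation bound is divided by its tuned rate `√(m / T)` in this way, since `√(m
/ T) * √(m * T) = m`. -/
theorem le_mul_sqrt_of_sqrt_div_mul_le {m T x c : ℝ} (hm : 0 < m) (hT : 0 < T)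
    (h : √(m / T) * x ≤ c * m) : x ≤ c * √(m * T) := by
  have hpos : 0 < √(m / T) := Real.sqrt_pos.2 (div_pos hm hT)
  have heq : √(m / T) * √(m * T) = m := by
    rw [← Real.sqrt_mul (div_pos hm hT).le, show m / T * (m * T) = m * m by field_simp,
      Real.sqrt_mul_self hm.le]
  refine le_of_mul_le_mul_left ?_ hpos
  calc _ ≤ c * m := h
    _ = √(m / T) * (c * √(m * T)) := by rw [mul_left_comm, heq]

theorem lt_log_inv_of_mul_exp_lt_one {A x : ℝ} (hA : 0 < A) (h : A * Real.exp x < 1) :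
    x < Real.log A⁻¹ := by
  rw [Real.lt_log_iff_exp_lt (inv_pos.2 hA), ← one_div, lt_div_iff₀ hA]
  linarith

variable {n : ℕ} {Z : Type u} {K : Type v} [Fintype K] [MeasurableSpace Z] {loss : K → Z → ℝ}

/-- The constant `19 / 2` is the sum of 2 (Azuma), 3/2 (learner's regret), 4 (auditor's regret) and
2 (implicit exploration). -/
theorem mixedRisk_le_of_gamePotential_lt_one [NeZero n] [Nonempty K]
    (hloss : ∀ f, Measurable (loss f)) (h01 : ∀ f z, loss f z ∈ Set.Icc (0 : ℝ) 1)
    (hcard : 2 ≤ Fintype.card K) {δ : ℝ} (hδ : 0 < δ) (hδ1 : δ < 1) {T t : ℕ} (hT : T = t + 1)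
    (hTΓ : Real.log (Fintype.card K) + n * Real.log (n / δ) ≤ T)
    (D : Fin n → Measure Z) [∀ i, IsProbabilityMeasure (D i)] {h : K} {opt : ℝ}
    {s : DynamicsState n K} {Θ : K → ℝ} {P G : ℝ}
    (hs : s.Invariant √(Real.log (Fintype.card K) / T) √(Real.log (n / δ) / (n * T))
      (√(Real.log (n / δ) / (n * T)) / 2) Θ P G t)
    (hlt : gamePotential loss D (δ / 2) (δ / (2 * n)) (√(Real.log (n / δ) / (n * T)) / 2)
      √(Real.log (2 / δ) / T) opt h s Θ P G t < 1) (j : Fin n) :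
    mixedRisk loss D Θ j ≤
      t * opt + 19 / 2 * √((Real.log (Fintype.card K) + n * Real.log (n / δ)) * T) := by
  set a := Real.log (Fintype.card K) with ha
  set l := Real.log (n / δ) with hl
  set M := Real.log (2 / δ) with hM
  set U := √((a + n * l) * T) with hU
  have hn1 : (1 : ℝ) ≤ n := by exact_mod_cast NeZero.one_le
  have hn0 : (0 : ℝ) < n := by linarith
  have hT0 : (0 : ℝ) < T := by rw [hT]; positivity
  have htT : (t : ℝ) ≤ T := by rw [hT]; push_cast; linarith
  have ha0 : 0 < a := Real.log_pos (by exact_mod_cast hcard)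
  have hnδ : 1 < n / δ := by rw [lt_div_iff₀ hδ]; linarith
  have hl0 : 0 < l := Real.log_pos hnδ
  have hlogn : Real.log n ≤ l :=
    Real.log_le_log hn0 (by rw [le_div_iff₀ hδ]; nlinarith)
  have hM0 : 0 < M := Real.log_pos (by rw [lt_div_iff₀ hδ]; linarith)
  have hMle : M ≤ a + n * l := by
    have h1 : M = Real.log 2 + Real.log (1 / δ) := by
      rw [hM, ← Real.log_mul (by norm_num) (by positivity)]
      ring_nf
    -- Having two hypotheses is what absorbs the `log 2` of the union bound, even when `δ` is close
    -- to 1.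
    have h2 : Real.log 2 ≤ a := Real.log_le_log (by norm_num) (by exact_mod_cast hcard)
    have h3 : Real.log (1 / δ) ≤ l := Real.log_le_log (by positivity) (by gcongr)
    nlinarith
  set S := ∑ i, δ / (2 * n) * Real.exp (2 * (√(l / (n * T)) / 2) *
      ((s.auditorCosts.map fun c => c i).sum - (t - mixedRisk loss D Θ i))) with hS
  have hSnn : ∀ i ∈ Finset.univ, 0 ≤ δ / (2 * n) * Real.exp (2 * (√(l / (n * T)) / 2) *
      ((s.auditorCosts.map fun c => c i).sum - (t - mixedRisk loss D Θ i))) :=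
    fun i _ => by positivity
  set V := if n = 1 then mixedRisk loss D Θ 0 else t - G with hV
  set c := (s.learnerCosts.map fun c => c h).sum with hc
  have hazuma : V - t * opt - P + c ≤ 2 * U := by
    have h1 : δ / 2 * Real.exp (√(M / T) * (V - t * opt - P + c) - √(M / T) ^ 2 * t) < 1 :=
      lt_of_le_of_lt (le_add_of_nonneg_right (Finset.sum_nonneg hSnn)) hlt
    have h2 := lt_log_inv_of_mul_exp_lt_one (by positivity) h1
    rw [inv_div, ← hM, Real.sq_sqrt (by positivity)] at h2
    have h3 : M / T * t ≤ M := by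
      rw [div_mul_eq_mul_div, div_le_iff₀ hT0]
      exact mul_le_mul_of_nonneg_left htT hM0.le
    refine (le_mul_sqrt_of_sqrt_div_mul_le (c := 2) hM0 hT0 (by linarith)).trans ?_
    exact mul_le_mul_of_nonneg_left (Real.sqrt_le_sqrt (by gcongr)) (by norm_num)
  have hlearner : P - c ≤ 3 / 2 * U := by
    have h1 := (neg_mul_le_hedgePotential √(a / T) s.learnerCosts h).trans hs.learner_regret
    rw [← hc, ← ha, Real.sq_sqrt (by positivity)] at h1
    have h3 : a / T * t ≤ a := by
      rw [div_mul_eq_mul_div, div_le_iff₀ hT0]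
      exact mul_le_mul_of_nonneg_left htT ha0.le
    refine (le_mul_sqrt_of_sqrt_div_mul_le (c := 3 / 2) ha0 hT0 (by linarith)).trans ?_
    refine mul_le_mul_of_nonneg_left (Real.sqrt_le_sqrt ?_) (by norm_num)
    gcongr
    linarith [mul_pos hn0 hl0]
  have hU0 : 0 ≤ U := Real.sqrt_nonneg _
  suffices hVj : mixedRisk loss D Θ j ≤ V + 6 * U by linarith
  -- For `n = 1` the rate depends on `log (1 / δ)`, which can be far below `log 2`, so the bound
  -- `log (2 * n / δ) ≤ 2 * l` fails. There `V` is by definition the exact risk, and no auditor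
  -- estimate is needed.
  by_cases hn : n = 1
  · subst hn
    rw [hV, if_pos rfl, Subsingleton.elim j 0]
    linarith
  rw [hV, if_neg hn]
  have hn2 : (2 : ℝ) ≤ n := by
    have : 2 ≤ n := by have := NeZero.one_le (n := n); omega
    exact_mod_cast this
  set η := √(l / (n * T)) with hη
  set U' := √(l * (n * T)) with hU'
  have hnT : (0 : ℝ) < n * T := by positivity
  have hU'U : U' ≤ U := Real.sqrt_le_sqrt (by nlinarith)
  have hU'T : U' ≤ T := Real.sqrt_le_iff.2 ⟨hT0.le, by nlinarith⟩
  have hix : ∀ k, (s.auditorCosts.map fun c => c k).sum - (t - mixedRisk loss D Θ k) ≤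
      2 * U' := by
    intro k
    have h1 : δ / (2 * n) * Real.exp (2 * (η / 2) *
        ((s.auditorCosts.map fun c => c k).sum - (t - mixedRisk loss D Θ k))) < 1 :=
      lt_of_le_of_lt ((Finset.single_le_sum hSnn (Finset.mem_univ k)).trans
        (le_add_of_nonneg_left (by positivity))) hlt
    have h2 := lt_log_inv_of_mul_exp_lt_one (by positivity) h1
    have h3 : Real.log (δ / (2 * n))⁻¹ ≤ 2 * l := by
      rw [inv_div, mul_div_assoc, Real.log_mul (by norm_num) (by positivity), ← hl]
      have : Real.log 2 ≤ l := (Real.log_le_log (by norm_num) hn2).trans hlogn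
      linarith
    exact le_mul_sqrt_of_sqrt_div_mul_le hl0 hnT (by rw [← hη]; linarith)
  have hΘ : ∀ k, 0 ≤ mixedRisk loss D Θ k := fun k => Finset.sum_nonneg fun f _ =>
    mul_nonneg (hs.nonneg f) (integral_loss_mem_Icc hloss h01 (D k) f).1
  have hregret : G - (s.auditorCosts.map fun c => c j).sum ≤ 4 * U' := by
    have h1 := (neg_mul_le_hedgePotential η s.auditorCosts j).trans hs.auditor_regret
    -- Each cumulative estimate is at most `t + 2 * U' ≤ 3 * T`; `U' ≤ T` is where the lower bound
    -- on `T` enters.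
    have h2 : ∑ k, (s.auditorCosts.map fun c => c k).sum ≤ 3 * (n * T) :=
      calc ∑ k, (s.auditorCosts.map fun c => c k).sum ≤ ∑ k : Fin n, 3 * (T : ℝ) :=
            Finset.sum_le_sum fun k _ => by linarith [hix k, hΘ k]
        _ = 3 * (n * T) := by simp; ring
    have h3 : η * (η / 2 + η / 2) * ∑ k, (s.auditorCosts.map fun c => c k).sum ≤ 3 * l := by
      have hηη : η * (η / 2 + η / 2) = l / (n * T) := by
        rw [add_halves, hη, Real.mul_self_sqrt (by positivity)]
      rw [hηη]
      calc _ ≤ l / (n * T) * (3 * (n * T)) := mul_le_mul_of_nonneg_left h2 (by positivity)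
        _ = 3 * l := by field_simp
    exact le_mul_sqrt_of_sqrt_div_mul_le hl0 hnT (by rw [← hη]; linarith)
  linarith [hix j]

theorem law_hedgeMultiDistLearn_le [NeZero n] [Nonempty K]
    (hloss : ∀ f, Measurable (loss f)) (h01 : ∀ f z, loss f z ∈ Set.Icc (0 : ℝ) 1)
    (hcard : 2 ≤ Fintype.card K) {δ : ℝ} (hδ : 0 < δ) (hδ1 : δ < 1) {T : ℕ}
    (hTΓ : Real.log (Fintype.card K) + n * Real.log (n / δ) ≤ T)
    (D : Fin n → Measure Z) [∀ i, IsProbabilityMeasure (D i)] {h : K} {opt : ℝ}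
    (hopt : ∀ i, ∫ z, loss h z ∂D i ≤ opt) :
    (hedgeMultiDistLearn n loss T δ).law D {q | ∃ i, opt +
      12 * √((Real.log (Fintype.card K) + n * Real.log (n / δ)) / T) < mixedRisk loss D q i} ≤
      ENNReal.ofReal δ := by
  set Γ := Real.log (Fintype.card K) + n * Real.log (n / δ) with hΓ
  have hn1 : (1 : ℝ) ≤ n := by exact_mod_cast NeZero.one_le
  have hΓ2 : Real.log 2 ≤ Γ := by
    have h1 : Real.log 2 ≤ Real.log (Fintype.card K) :=
      Real.log_le_log (by norm_num) (by exact_mod_cast hcard)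
    have h2 : 0 ≤ Real.log (n / δ) := Real.log_nonneg (by rw [le_div_iff₀ hδ]; linarith)
    have := mul_nonneg (by linarith : (0 : ℝ) ≤ n) h2
    linarith
  have hΓ0 : 1 / 2 < Γ := by linarith [Real.log_two_gt_d9]
  have hT0 : (0 : ℝ) < T := by linarith
  have hTne : T ≠ 0 := by rintro rfl; simp at hT0
  obtain ⟨t, rfl⟩ := Nat.exists_eq_succ_of_ne_zero hTne
  have hopt0 : 0 ≤ opt := (integral_loss_mem_Icc hloss h01 (D 0) h).1.trans (hopt 0)
  have hmeas : MeasurableSet {q : K → ℝ | ∃ i, opt +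
      12 * √(Γ / (t + 1 : ℕ)) < mixedRisk loss D q i} := by
    rw [Set.ofPred_exists]
    exact .iUnion fun i => measurableSet_lt measurable_const
      (Finset.measurable_sum _ fun f _ => (measurable_pi_apply f).mul_const _)
  set ηL := √(Real.log (Fintype.card K) / (t + 1 : ℕ)) with hηL
  set η := √(Real.log (n / δ) / (n * (t + 1 : ℕ))) with hη
  have hinit : DynamicsState.Invariant ηL η (η / 2)
      (⟨[hedge ηL []], [], []⟩ : DynamicsState n K) 0 0 0 0 := by
    refine ⟨by simp, by simp, by simp, ?_, ?_⟩ <;> simp [hedgePotential]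
  refine (law_dynamics_le_gamePotential hloss h01 (Real.sqrt_nonneg _) (Real.sqrt_nonneg _)
    (by positivity) (Real.sqrt_nonneg (Real.log (2 / δ) / (t + 1 : ℕ)))
    (by positivity : 0 ≤ δ / 2) (by positivity : 0 ≤ δ / (2 * n)) D hopt hmeas t ?_ t _ 0 0 0 0
    hinit (by simp)).trans_eq ?_
  · rintro s Θ P G hs ⟨j, hj⟩
    by_contra! hlt
    have h1 := mixedRisk_le_of_gamePotential_lt_one hloss h01 hcard hδ hδ1 rfl hTΓ D hs hlt j
    have h2 : mixedRisk loss D (fun f => (s.actions.map fun θ => θ f).sum / s.actions.length) j =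
        (mixedRisk loss D Θ j + mixedRisk loss D (hedge ηL s.learnerCosts) j) / (t + 1 : ℕ) := by
      simp only [hs.sum_actions, hs.length_actions]
      rw [← mixedRisk_add]
      simp only [mixedRisk, Finset.sum_div, Pi.add_apply]
      exact Finset.sum_congr rfl fun f _ => by ring
    -- The last action is never charged, so its risk is bounded by 1. The slack `12 - 19 / 2 = 5 /
    -- 2` times the root, which is at least `1 / 2` by `h5`, covers it.
    have h3 := (mixedRisk_mem_Icc hloss h01 D (hedge_mem_stdSimplex ηL s.learnerCosts) j).2
    rw [h2, lt_div_iff₀ hT0, add_mul, mul_assoc] at hj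
    have h4 : √(Γ / (t + 1 : ℕ)) * (t + 1 : ℕ) = √(Γ * (t + 1 : ℕ)) := by
      rw [← Real.sqrt_mul_self hT0.le, ← Real.sqrt_mul (by positivity),
        Real.sqrt_mul_self hT0.le]
      congr 1
      field_simp
    have h5 : 1 / 2 ≤ √(Γ * (t + 1 : ℕ)) := by
      refine Real.le_sqrt_of_sq_le ?_
      push_cast
      nlinarith [(Nat.cast_nonneg t : (0 : ℝ) ≤ t)]
    rw [h4] at hj
    push_cast at hj h1 h5
    linarith
  -- The initial potential is `δ / 2 + n * (δ / (2 * n)) = δ`.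
  · congr 1
    have : (n : ℝ) ≠ 0 := by linarith
    simp only [gamePotential, mixedRisk]
    simp
    field_simp
    norm_num

end Final

/-! ### The main theorem -/

theorem mainTheorem1 :
    ∃ C : ℝ, 0 < C ∧
      ∀ (X : Type u) (Y : Type v) [MeasurableSpace X] [MeasurableSpace Y]
        (n : ℕ) (_ : 0 < n) (H : Finset (X → Y)) (_ : H.Nonempty)
        (ℓ : (X → Y) → X × Y → ℝ)
        (_ : ∀ h ∈ H, Measurable (ℓ h))
        (_ : ∀ h ∈ H, ∀ z, ℓ h z ∈ Set.Icc (0 : ℝ) 1)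
        (ε δ : ℝ) (_ : 0 < ε) (_ : 0 < δ) (_ : δ < 1),
        -- with at least the stated number of iterations, for all distributions `D 0, …, D (n-1)`,
        -- the output is `ε`-optimal with probability at least `1 - δ`
        (∀ T : ℕ, C * (Real.log H.card + n * Real.log (n / δ)) / ε ^ 2 ≤ T →
          ∀ (D : Fin n → MeasureTheory.Measure (X × Y))
            [∀ i, MeasureTheory.IsProbabilityMeasure (D i)],
            MeasureTheory.IsProbabilityMeasure
              ((hedgeMultiDistLearn n (fun (f : H) z => ℓ f z) T δ).law D) ∧
            ENNReal.ofReal (1 - δ) ≤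
              (hedgeMultiDistLearn n (fun (f : H) z => ℓ f z) T δ).law D
                {q | IsEpsOptimal ℓ D ε q}) ∧
        -- and that number of iterations makes the stated number of oracle calls
        ∃ m : ℕ,
          (hedgeMultiDistLearn n (fun (f : H) z => ℓ f z)
              ⌈C * (Real.log H.card + n * Real.log (n / δ)) / ε ^ 2⌉₊ δ).maxCalls ≤ m ∧
          (m : ℝ) ≤ 2 * C * (Real.log H.card + n * Real.log (n / δ)) / ε ^ 2 := by
  -- `144 = 12 ^ 2`, so that `12 * √(Γ / T) ≤ ε`.
  refine ⟨144, by norm_num, fun X Y _ _ n hn H hH ℓ hℓ hℓ01 ε δ hε hδ hδ1 => ?_⟩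
  have : NeZero n := ⟨hn.ne'⟩
  have : Nonempty H := hH.to_subtype
  have hn1 : (1 : ℝ) ≤ n := by exact_mod_cast hn
  set Γ := Real.log H.card + n * Real.log (n / δ) with hΓ
  have hΓ0 : 0 < Γ := by
    have h1 : 0 ≤ Real.log (H.card : ℝ) := Real.log_natCast_nonneg _
    have h2 : 0 < Real.log (n / δ) := Real.log_pos (by rw [lt_div_iff₀ hδ]; linarith)
    positivity
  -- The first iteration makes no oracle call; the saved round absorbs the rounding up of `T`.
  refine ⟨fun T hT D _ => ?_, 2 * (⌈144 * Γ / ε ^ 2⌉₊ - 1), ?_, ?_⟩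
  · set loss : H → X × Y → ℝ := fun f z => ℓ f z with hloss
    have hmeas : ∀ f, Measurable (loss f) := fun f => hℓ f f.2
    have h01 : ∀ f z, loss f z ∈ Set.Icc (0 : ℝ) 1 := fun f => hℓ01 f f.2
    set μ := (hedgeMultiDistLearn n loss T δ).law D with hμ
    have hprob : IsProbabilityMeasure μ :=
      isProbabilityMeasure_law_dynamics hmeas _ _ _ D (T - 1) _
    refine ⟨hprob, ?_⟩
    have hsimplex : μ (stdSimplex ℝ H)ᶜ = 0 :=
      law_dynamics_compl_stdSimplex hmeas _ _ _ D (T - 1) _ (by simp) (by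
        simp only [List.mem_singleton, forall_eq]
        exact hedge_mem_stdSimplex _ _)
    obtain ⟨h, hh⟩ := exists_eq_ciInf_of_finite (f := fun h : H => ⨆ i, risk ℓ (D i) h)
    have hopt : ∀ i, ∫ z, loss h z ∂D i ≤ collabOPT ℓ D H := fun i => by
      rw [collabOPT, ← hh]
      exact le_ciSup (f := fun i => risk ℓ (D i) h) (Set.finite_range _).bddAbove i
    have hopt0 : 0 ≤ collabOPT ℓ D H :=
      (integral_loss_mem_Icc hmeas h01 (D 0) h).1.trans (hopt 0)
    have hsub : {q | IsEpsOptimal ℓ D ε q}ᶜ ⊆ (stdSimplex ℝ H)ᶜ ∪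
        {q | q ∈ stdSimplex ℝ H ∧ ∃ i, collabOPT ℓ D H + ε < mixedRisk loss D q i} := by
      intro q hq
      by_cases hqs : q ∈ stdSimplex ℝ H
      · refine Or.inr ⟨hqs, ?_⟩
        by_contra! hcon
        exact hq ⟨hqs, ciSup_le hcon⟩
      · exact Or.inl hqs
    have hbad : μ {q | q ∈ stdSimplex ℝ H ∧
        ∃ i, collabOPT ℓ D H + ε < mixedRisk loss D q i} ≤ ENNReal.ofReal δ := by
      -- Risks lie in `[0, 1]`, so `ε ≥ 1` is trivial; otherwise the bound on `T` also gives `Γ ≤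
      -- T`. A class with one hypothesis is trivial too and is split off because it supplies no `log
      -- 2`.
      by_cases hε1 : 1 ≤ ε
      · refine (measure_mono_null (t := ∅) ?_ measure_empty).trans_le zero_le
        rintro q ⟨hq, i, hi⟩
        linarith [(mixedRisk_mem_Icc hmeas h01 D hq i).2]
      by_cases hcard : 2 ≤ Fintype.card H
      · have hε2 : ε ^ 2 ≤ 1 := by nlinarith
        have hTε : 144 * Γ ≤ T * ε ^ 2 := (div_le_iff₀ (by positivity)).1 hT
        have hTΓ : Γ ≤ T := by nlinarith [(Nat.cast_nonneg T : (0 : ℝ) ≤ T)]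
        have hT0 : (0 : ℝ) < T := hΓ0.trans_le hTΓ
        have hsq : 12 * √(Γ / T) ≤ ε := by
          have : √(Γ / T) ≤ ε / 12 := by
            refine Real.sqrt_le_iff.2 ⟨by positivity, ?_⟩
            rw [div_le_iff₀ hT0]
            linarith
          linarith
        have hlaw := law_hedgeMultiDistLearn_le hmeas h01 hcard hδ hδ1 (T := T)
          (by rwa [Fintype.card_coe]) D hopt
        rw [Fintype.card_coe] at hlaw
        refine (measure_mono ?_).trans hlaw
        rintro q ⟨-, i, hi⟩
        exact ⟨i, by linarith⟩
      · have hsing : Subsingleton H := by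
          rw [← Fintype.card_le_one_iff_subsingleton]
          omega
        refine (measure_mono_null (t := ∅) ?_ measure_empty).trans_le zero_le
        rintro q ⟨hq, i, hi⟩
        have : mixedRisk loss D q i ≤ collabOPT ℓ D H := by
          have heq : mixedRisk loss D q i = ∑ f, q f * ∫ z, loss h z ∂D i :=
            Finset.sum_congr rfl fun f _ => by rw [Subsingleton.elim f h]
          rw [heq, ← Finset.sum_mul, hq.2, one_mul]
          exact hopt i
        linarith
    have hcompl : μ {q | IsEpsOptimal ℓ D ε q}ᶜ ≤ ENNReal.ofReal δ :=
      (measure_mono hsub).trans ((measure_union_le _ _).trans (by rwa [hsimplex, zero_add]))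
    have hone : 1 ≤ μ {q | IsEpsOptimal ℓ D ε q} + μ {q | IsEpsOptimal ℓ D ε q}ᶜ := by
      rw [← measure_univ (μ := μ), ← Set.union_compl_self {q | IsEpsOptimal ℓ D ε q}]
      exact measure_union_le _ _
    rw [ENNReal.ofReal_sub _ hδ.le, ENNReal.ofReal_one, tsub_le_iff_right]
    exact hone.trans (add_le_add_right hcompl _)
  · exact maxCalls_dynamics_le _ _ _ _ _ _
  · have hpos : 0 < 144 * Γ / ε ^ 2 := by positivity
    have h1 := Nat.ceil_lt_add_one hpos.le
    have h2 : 1 ≤ ⌈144 * Γ / ε ^ 2⌉₊ := Nat.one_le_ceil_iff.2 hpos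
    rw [Nat.cast_mul, Nat.cast_sub h2]
    push_cast
    have h3 : 2 * 144 * Γ / ε ^ 2 = 2 * (144 * Γ / ε ^ 2) := by ring
    rw [h3]
    linarith
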